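/- Let $\nu,\alpha>0$ and let $X=(X_s)_{s\ge 0}$ be a Gamma subordinator with parameters $\nu,\alpha$, that is, a driftless Lévy subordinator (a process with $X_0=0$ almost surely, independent and stationary increments, and almost surely nondecreasing right-continuous paths) with Lévy density $w(x)=\nu e^{-\alpha x}/x$, $x>0$; equivalently, $\mathbb{E}[e^{-zX_s}]=e^{-s\psi(z)}$ for all $s,z\ge 0$, where $\psi(z)=\int_0^\infty(1-e^{-zu})\,w(u)\,du$. For $t>0$ let $T_t=\inf\{\tau>0: X_\tau\ge t\}\in[0,\infty]$ (with $\inf\emptyset=\infty$) be its first-exit time. Then $T_t$ is measurable (up to a null set), and its mean is finite and given by the convergent double integral $$\mathbb{E}[T_t]=\int_0^t\int_0^\infty \frac{\alpha\, e^{-\lambda\alpha}(\lambda\alpha)^{u-1}}{\nu\,\Gamma(u)}\,du\,d\lambda .$$ -/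

import Mathlib

open MeasureTheory ProbabilityTheory Set
open scoped NNReal ENNReal

/-- A (Lévy) subordinator on the probability space `(Ω, P)`: a real process started at `0`, with
independent and stationary increments, almost all of whose paths are nondecreasing and
right-continuous (hence càdlàg, a nondecreasing path having left limits everywhere). -/
structure IsSubordinator {Ω : Type*} [MeasurableSpace Ω] (X : ℝ≥0 → Ω → ℝ)
    (P : Measure Ω) : Prop where
  aemeasurable : ∀ s, AEMeasurable (X s) P
  zero : ∀ᵐ ω ∂P, X 0 ω = 0
  indep : HasIndepIncrements X P
  stationary : ∀ s h, IdentDistrib (fun ω ↦ X (s + h) ω - X s ω) (X h) P P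
  paths : ∀ᵐ ω ∂P, Monotone (fun s ↦ X s ω) ∧
    ∀ s, ContinuousWithinAt (fun r ↦ X r ω) (Ici s) s

/-- The Laplace exponent `ψ(z) = ∫_0^∞ (1 - e^{-zu}) w(u) du` of the driftless subordinators with
Lévy density `w`. -/
noncomputable def laplaceExponent (w : ℝ → ℝ) (z : ℝ) : ℝ :=
  ∫ u in Ioi (0 : ℝ), (1 - Real.exp (-(z * u))) * w u

/-- `X` has Lévy density `w` (and no drift): `w(u) du` is the Lévy measure of a subordinator, that
is, `w ≥ 0` and `∫_0^∞ min(1, u) w(u) du < ∞`, and the Lévy–Khinchin representation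
`E[e^{-z X_s}] = e^{-s ψ(z)}` holds for all `s, z ≥ 0`. -/
structure HasLevyDensity {Ω : Type*} [MeasurableSpace Ω] (X : ℝ≥0 → Ω → ℝ) (w : ℝ → ℝ)
    (P : Measure Ω) : Prop where
  nonneg : ∀ u, 0 < u → 0 ≤ w u
  integrable : IntegrableOn (fun u ↦ min 1 u * w u) (Ioi 0)
  laplace : ∀ (s : ℝ≥0) (z : ℝ), 0 ≤ z →
    ∫ ω, Real.exp (-(z * X s ω)) ∂P = Real.exp (-(s * laplaceExponent w z))

/-- A Gamma subordinator with parameters `ν, α`: a subordinator with Lévy density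
`ν e^{-α u} / u` on `u > 0`. -/
structure IsGammaSubordinator {Ω : Type*} [MeasurableSpace Ω] (X : ℝ≥0 → Ω → ℝ) (ν α : ℝ)
    (P : Measure Ω) : Prop where
  isSubordinator : IsSubordinator X P
  hasLevyDensity : HasLevyDensity X (fun u ↦ ν * Real.exp (-(α * u)) / u) P

/-- The first-exit time `T_t = inf {τ > 0 : X_τ ≥ t}`, equal to `∞` where the set is empty. -/
noncomputable def firstExitTime {Ω : Type*} (X : ℝ≥0 → Ω → ℝ) (t : ℝ) (ω : Ω) : ℝ≥0∞ :=
  sInf ((fun τ : ℝ≥0 ↦ (τ : ℝ≥0∞)) '' {τ : ℝ≥0 | 0 < τ ∧ t ≤ X τ ω})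

/-!
The mean of a nonnegative random variable is the integral of its tail, so that
`E[T_t] = ∫_0^∞ P(T_t > s) ds`. Along a nondecreasing right-continuous path, `T_t > s` holds exactly
when `X_s < t` (`coe_lt_firstExitTime_iff`), hence `E[T_t] = ∫_0^∞ P(X_s < t) ds`
(`IsSubordinator.lintegral_firstExitTime`). Only one-dimensional laws are left in this expression.

The Laplace exponent of the Gamma subordinator is a Frullani integral, `ψ(z) = ν log (1 + z / α)`
(`laplaceExponent_gamma`). Thus `X_s` has the Laplace transform `(α / (α + z)) ^ (ν s)` of the Gamma
law with shape `ν s` and rate `α`, and is distributed according to that law, since a finite measure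
on `[0, ∞)` is determined by its Laplace transform: mapped to `[0, 1]` by `x ↦ e^{-x}`, the Laplace
transform at the natural numbers becomes the sequence of moments, and the Weierstrass approximation
theorem applies (`MeasureTheory.Measure.ext_of_integral_exp_neg_nat_mul`). Inserting the Gamma
density, exchanging the integrals by Tonelli's theorem and substituting `u = ν s` gives the formula
in `[0, ∞]` (`IsGammaSubordinator.lintegral_firstExitTime`).

The mean is finite because `P(X_s < t) ≤ e^t e^{-s ψ(1)}` by Markov's inequality
(`lintegral_firstExitTime_lt_top`), so the double integral converges absolutely and the inner one
converges for almost every `l`. It converges for every `l` because `(l α) ^ (u - 1)` is monotone in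
`l`, increasing or decreasing according to the sign of `u - 1`: the integrand at `l` is dominated by
a combination of those at two points, one on either side
(`integrableOn_gammaExitDensity_of_between`).
-/

open Filter Topology

/-! ### Uniqueness for the Laplace transform -/

/-- Two finite measures on the unit interval with the same moments coincide, since polynomials are
uniformly dense in the continuous functions. -/
theorem MeasureTheory.Measure.ext_of_moments_unitInterval {μ μ' : Measure unitInterval}
    [IsFiniteMeasure μ] [IsFiniteMeasure μ']
    (h : ∀ n : ℕ, ∫ x, (x : ℝ) ^ n ∂μ = ∫ x, (x : ℝ) ^ n ∂μ') : μ = μ' := by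
  have cont (ρ : Measure unitInterval) [IsFiniteMeasure ρ] :
      Continuous fun f : C(unitInterval, ℝ) ↦ ∫ x, f x ∂ρ := by
    have hint (f : C(unitInterval, ℝ)) : Integrable f ρ :=
      f.continuous.integrable_of_hasCompactSupport (HasCompactSupport.of_compactSpace f)
    refine LipschitzWith.continuous (K := (ρ.real univ).toNNReal) (.of_dist_le_mul fun f g ↦ ?_)
    rw [dist_eq_norm, ← integral_sub (hint f) (hint g), Real.coe_toNNReal _ measureReal_nonneg,
      mul_comm]
    exact norm_integral_le_of_norm_le_const
      (ae_of_all _ fun x ↦ (dist_eq_norm (f x) (g x)).symm ▸ f.dist_apply_le_dist x)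
  have hpoly (p : Polynomial ℝ) :
      ∫ x : unitInterval, p.eval (x : ℝ) ∂μ = ∫ x : unitInterval, p.eval (x : ℝ) ∂μ' := by
    have hint (ρ : Measure unitInterval) [IsFiniteMeasure ρ] (n : ℕ) :
        Integrable (fun x : unitInterval ↦ p.coeff n * (x : ℝ) ^ n) ρ :=
      (by fun_prop : Continuous fun x : unitInterval ↦ p.coeff n * (x : ℝ) ^ n)
        |>.integrable_of_hasCompactSupport (HasCompactSupport.of_compactSpace _)
    simp_rw [Polynomial.eval_eq_sum_range]
    rw [integral_finsetSum _ fun n _ ↦ hint μ n, integral_finsetSum _ fun n _ ↦ hint μ' n]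
    simp_rw [integral_const_mul, h]
  have hclosed : IsClosed {f : C(unitInterval, ℝ) | ∫ x, f x ∂μ = ∫ x, f x ∂μ'} :=
    isClosed_eq (cont μ) (cont μ')
  refine ext_of_forall_integral_eq_of_IsFiniteMeasure fun f ↦ ?_
  have hmem : f.toContinuousMap ∈ (polynomialFunctions unitInterval).topologicalClosure := by
    rw [polynomialFunctions_closure_eq_top']
    trivial
  refine closure_minimal (fun g hg ↦ ?_) hclosed hmem
  obtain ⟨p, -, rfl⟩ := hg
  exact hpoly p

/-- A finite measure on `[0, ∞)` is determined by the values of its Laplace transform at the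
natural numbers: these are the moments of its image under `x ↦ e^{-x}`. -/
theorem MeasureTheory.Measure.ext_of_integral_exp_neg_nat_mul {μ μ' : Measure ℝ}
    [IsFiniteMeasure μ] [IsFiniteMeasure μ'] (hμ : ∀ᵐ x ∂μ, 0 ≤ x) (hμ' : ∀ᵐ x ∂μ', 0 ≤ x)
    (h : ∀ n : ℕ, ∫ x, Real.exp (-(n * x)) ∂μ = ∫ x, Real.exp (-(n * x)) ∂μ') : μ = μ' := by
  -- Truncating at `0` makes `x ↦ e^{-x}` take values in the unit interval everywhere.
  let e : ℝ → unitInterval := fun x ↦ ⟨Real.exp (-(max x 0)), (Real.exp_pos _).le,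
    Real.exp_le_one_iff.mpr (neg_nonpos.mpr (le_max_right _ _))⟩
  have he : Measurable e := by
    refine Measurable.subtype_mk ?_
    fun_prop
  have hl : Measurable fun y : unitInterval ↦ -Real.log y := by fun_prop
  have moment (ρ : Measure ℝ) (hρ : ∀ᵐ x ∂ρ, 0 ≤ x) (n : ℕ) :
      ∫ y, (y : ℝ) ^ n ∂(ρ.map e) = ∫ x, Real.exp (-(n * x)) ∂ρ := by
    rw [integral_map he.aemeasurable (by fun_prop)]
    refine integral_congr_ae ?_
    filter_upwards [hρ] with x hx
    simp only [e, max_eq_left hx, ← Real.exp_nat_mul, mul_neg]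
  have back (ρ : Measure ℝ) (hρ : ∀ᵐ x ∂ρ, 0 ≤ x) :
      (ρ.map e).map (fun y : unitInterval ↦ -Real.log y) = ρ := by
    rw [Measure.map_map hl he]
    refine (Measure.map_congr ?_).trans Measure.map_id
    filter_upwards [hρ] with x hx
    simp [e, hx]
  have key : μ.map e = μ'.map e :=
    Measure.ext_of_moments_unitInterval fun n ↦ by rw [moment μ hμ, moment μ' hμ', h]
  rw [← back μ hμ, ← back μ' hμ', key]

/-! ### The one-dimensional laws of the Gamma subordinator -/

theorem ProbabilityTheory.ae_nonneg_gammaMeasure (a r : ℝ) : ∀ᵐ x ∂gammaMeasure a r, 0 ≤ x := by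
  have h : gammaMeasure a r (Iio 0) = 0 := by
    rw [gammaMeasure, withDensity_apply _ measurableSet_Iio, lintegral_gammaPDF_of_nonpos le_rfl]
  rw [ae_iff]
  simp only [not_le]
  exact h

theorem ProbabilityTheory.integral_exp_neg_mul_gammaMeasure {a r z : ℝ} (ha : 0 < a) (hr : 0 < r)
    (hz : 0 ≤ z) : ∫ x, Real.exp (-(z * x)) ∂gammaMeasure a r = (r / (r + z)) ^ a := by
  have hpdf : Measurable (gammaPDF a r) := (measurable_gammaPDFReal a r).ennreal_ofReal
  rw [gammaMeasure, integral_withDensity_eq_integral_toReal_smul hpdf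
    (ae_of_all _ fun _ ↦ ENNReal.ofReal_lt_top)]
  have h0 : ∀ x, x ∉ Ici (0 : ℝ) → (gammaPDF a r x).toReal • Real.exp (-(z * x)) = 0 := by
    intro x hx
    rw [gammaPDF_of_neg (not_le.mp hx)]
    simp
  rw [← setIntegral_eq_integral_of_forall_compl_eq_zero h0, integral_Ici_eq_integral_Ioi]
  have h1 : ∀ x ∈ Ioi (0 : ℝ), (gammaPDF a r x).toReal • Real.exp (-(z * x)) =
      r ^ a / Real.Gamma a * (x ^ (a - 1) * Real.exp (-((r + z) * x))) := by
    intro x hx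
    have hx : 0 < x := hx
    rw [gammaPDF, ENNReal.toReal_ofReal (gammaPDFReal_nonneg ha hr x), gammaPDFReal,
      if_pos hx.le, smul_eq_mul, show -((r + z) * x) = -(r * x) + -(z * x) by ring, Real.exp_add]
    ring
  rw [setIntegral_congr_fun measurableSet_Ioi h1, integral_const_mul,
    Real.integral_rpow_mul_exp_neg_mul_Ioi ha (by positivity),
    Real.div_rpow hr.le (by positivity), Real.div_rpow zero_le_one (by positivity), Real.one_rpow]
  have := (Real.Gamma_pos_of_pos ha).ne'
  field_simp

/-- The Laplace exponent of the Gamma subordinator, a Frullani integral. -/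
theorem laplaceExponent_gamma {ν α z : ℝ} (hα : 0 < α) (hz : 0 ≤ z) :
    laplaceExponent (fun u ↦ ν * Real.exp (-(α * u)) / u) z = ν * Real.log ((α + z) / α) := by
  have hform : ∀ u ∈ Ioi (0 : ℝ), (1 - Real.exp (-(z * u))) * (ν * Real.exp (-(α * u)) / u) =
      ν * (u⁻¹ • (Real.exp (-(α * u)) - Real.exp (-((α + z) * u)))) := by
    intro u _
    rw [show -((α + z) * u) = -(z * u) + -(α * u) by ring, Real.exp_add, smul_eq_mul]
    ring
  have hint : IntegrableOn
      (fun u : ℝ ↦ u⁻¹ • (Real.exp (-(α * u)) - Real.exp (-((α + z) * u)))) (Ioi 0) := by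
    have hdom : IntegrableOn (fun u : ℝ ↦ z * Real.exp (-α * u)) (Ioi 0) :=
      (exp_neg_integrableOn_Ioi 0 hα).const_mul z
    refine Integrable.mono' hdom (by fun_prop) ((ae_restrict_iff' measurableSet_Ioi).mpr
      (ae_of_all _ fun u hu ↦ ?_))
    have hu : 0 < u := hu
    have h1 : 1 - Real.exp (-(z * u)) ≤ z * u := by
      linarith [Real.one_sub_le_exp_neg (z * u)]
    have h2 : 0 ≤ 1 - Real.exp (-(z * u)) :=
      sub_nonneg.mpr (Real.exp_le_one_iff.mpr (by nlinarith))
    have h3 : u⁻¹ • (Real.exp (-(α * u)) - Real.exp (-((α + z) * u))) =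
        u⁻¹ * (1 - Real.exp (-(z * u))) * Real.exp (-α * u) := by
      rw [show -((α + z) * u) = -(z * u) + -α * u by ring, Real.exp_add, smul_eq_mul, neg_mul]
      ring
    rw [h3, Real.norm_of_nonneg (by positivity)]
    gcongr
    rw [inv_mul_le_iff₀ hu]
    linarith
  have hcont : Continuous fun x : ℝ ↦ Real.exp (-x) := by fun_prop
  have key := Frullani.integral_Ioi_eq (f := fun x ↦ Real.exp (-x)) (a := α) (b := α + z)
    (L := 1) (R := 0) (hcont.locallyIntegrable.locallyIntegrableOn _) hα (by positivity)
    ((by simpa using hcont.tendsto 0 : Tendsto (fun x : ℝ ↦ Real.exp (-x)) (𝓝 0) (𝓝 1)).mono_left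
      nhdsWithin_le_nhds)
    Real.tendsto_exp_neg_atTop_nhds_zero hint
  rw [laplaceExponent, setIntegral_congr_fun measurableSet_Ioi hform, integral_const_mul, key]
  simp

section Law

variable {Ω : Type*} [MeasurableSpace Ω] {P : Measure Ω} {X : ℝ≥0 → Ω → ℝ} {ν α : ℝ}

theorem IsSubordinator.ae_nonneg (hX : IsSubordinator X P) (s : ℝ≥0) : ∀ᵐ ω ∂P, 0 ≤ X s ω := by
  filter_upwards [hX.zero, hX.paths] with ω h0 hp
  exact h0.symm.le.trans (hp.1 (zero_le (a := s)))

/-- At time `s > 0` the Gamma subordinator has the Gamma law with shape `ν s` and rate `α`. -/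
theorem IsGammaSubordinator.map_eq_gammaMeasure [IsProbabilityMeasure P] (hν : 0 < ν) (hα : 0 < α)
    (hX : IsGammaSubordinator X ν α P) {s : ℝ≥0} (hs : 0 < s) :
    P.map (X s) = gammaMeasure (ν * s) α := by
  have ha : 0 < ν * (s : ℝ) := by positivity
  have hm := hX.isSubordinator.aemeasurable s
  have : IsProbabilityMeasure (gammaMeasure (ν * s) α) := isProbabilityMeasure_gammaMeasure ha hα
  have : IsProbabilityMeasure (P.map (X s)) := Measure.isProbabilityMeasure_map hm
  refine Measure.ext_of_integral_exp_neg_nat_mul ?_ (ae_nonneg_gammaMeasure _ _) fun n ↦ ?_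
  · exact (ae_map_iff hm measurableSet_Ici).mpr (hX.isSubordinator.ae_nonneg s)
  have hn : (0 : ℝ) ≤ n := n.cast_nonneg
  rw [integral_map hm (by fun_prop), hX.hasLevyDensity.laplace s n hn,
    laplaceExponent_gamma hα hn, integral_exp_neg_mul_gammaMeasure ha hα hn,
    Real.rpow_def_of_pos (by positivity), ← inv_div, Real.log_inv]
  congr 1
  ring

end Law

/-! ### First-exit times of a subordinator -/

/-- The layer-cake formula for functions that may take the value `∞`. -/
theorem MeasureTheory.lintegral_eq_lintegral_meas_ofReal_lt {Ω : Type*} [MeasurableSpace Ω]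
    {μ : Measure Ω} [SFinite μ] {f : Ω → ℝ≥0∞} (hf : AEMeasurable f μ) :
    ∫⁻ ω, f ω ∂μ = ∫⁻ s in Ioi (0 : ℝ), μ {ω | ENNReal.ofReal s < f ω} := by
  wlog hm : Measurable f generalizing f
  · have hae := hf.ae_eq_mk
    rw [lintegral_congr_ae hae, this hf.measurable_mk.aemeasurable hf.measurable_mk]
    refine lintegral_congr fun s ↦ measure_congr ?_
    filter_upwards [hae] with ω hω
    change (_ < hf.mk f ω) = (_ < f ω)
    rw [hω]
  have hlen (c : ℝ≥0∞) :
      ∫⁻ s in Ioi (0 : ℝ), {s : ℝ | ENNReal.ofReal s < c}.indicator 1 s = c := by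
    have hms : MeasurableSet {s : ℝ | ENNReal.ofReal s < c} :=
      measurableSet_lt ENNReal.measurable_ofReal measurable_const
    rw [lintegral_indicator_one hms, Measure.restrict_apply hms]
    rcases eq_or_ne c ⊤ with rfl | hc
    · simp
    have : {s : ℝ | ENNReal.ofReal s < c} ∩ Ioi 0 = Ioo 0 c.toReal := by
      ext s
      simp only [mem_inter_iff, mem_ofPred, mem_Ioi, mem_Ioo]
      rw [and_comm]
      exact and_congr_right fun hs ↦ ENNReal.ofReal_lt_iff_lt_toReal hs.le hc
    rw [this, Real.volume_Ioo, sub_zero, ENNReal.ofReal_toReal hc]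
  let S : Set (Ω × ℝ) := {p | ENNReal.ofReal p.2 < f p.1}
  have hset : MeasurableSet S :=
    measurableSet_lt (by fun_prop) (by fun_prop)
  calc ∫⁻ ω, f ω ∂μ
      = ∫⁻ ω, (∫⁻ s in Ioi (0 : ℝ), S.indicator 1 (ω, s)) ∂μ :=
        lintegral_congr fun ω ↦ (hlen (f ω)).symm
    _ = ∫⁻ s in Ioi (0 : ℝ), ∫⁻ ω, S.indicator 1 (ω, s) ∂μ :=
        lintegral_lintegral_swap (f := fun ω s ↦ S.indicator 1 (ω, s))
          (measurable_one.indicator hset).aemeasurable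
    _ = ∫⁻ s in Ioi (0 : ℝ), μ {ω | ENNReal.ofReal s < f ω} :=
        lintegral_congr fun s ↦ lintegral_indicator_one (measurable_prodMk_right hset)

section FirstExit

variable {Ω : Type*} {X : ℝ≥0 → Ω → ℝ} {ω : Ω}

/-- Along a monotone path the infimum defining the first-exit time may be restricted to a countable
dense set of times. -/
theorem firstExitTime_eq_iInf_rat (hω : Monotone fun s ↦ X s ω) (t : ℝ) :
    firstExitTime X t ω = ⨅ q : {q : ℚ // 0 < q},
      if t ≤ X (q : ℝ).toNNReal ω then ENNReal.ofReal (q : ℝ) else ⊤ := by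
  refine le_antisymm (le_iInf fun q ↦ ?_) (le_sInf ?_)
  · split_ifs with hq
    · exact sInf_le ⟨_, ⟨Real.toNNReal_pos.mpr (Rat.cast_pos.mpr q.2), hq⟩, rfl⟩
    · exact le_top
  · rintro _ ⟨τ, ⟨hτ, hτt⟩, rfl⟩
    refine le_of_forall_gt fun c hc ↦ ?_
    obtain ⟨r, hτr, hrc⟩ := ENNReal.lt_iff_exists_nnreal_btwn.mp hc
    obtain ⟨q, -, hτq, hqr⟩ := (NNReal.lt_iff_exists_rat_btwn _ _).mp (ENNReal.coe_lt_coe.mp hτr)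
    have hq : 0 < q := Rat.cast_pos.mp (Real.toNNReal_pos.mp (hτ.trans hτq))
    refine (iInf_le _ ⟨q, hq⟩).trans_lt ?_
    rw [if_pos (hτt.trans (hω hτq.le))]
    exact (ENNReal.coe_lt_coe.mpr hqr).trans hrc

/-- Along a monotone right-continuous path, the exit above level `t` has not occurred by time
`s > 0` precisely when the path is still below `t` at time `s`. -/
theorem coe_lt_firstExitTime_iff (hω : Monotone fun s ↦ X s ω) {s : ℝ≥0} (hs : 0 < s)
    (hc : ContinuousWithinAt (fun r ↦ X r ω) (Ici s) s) (t : ℝ) :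
    (s : ℝ≥0∞) < firstExitTime X t ω ↔ X s ω < t := by
  constructor
  · intro h
    by_contra! hst
    exact (sInf_le ⟨s, ⟨hs, hst⟩, rfl⟩ : firstExitTime X t ω ≤ s).not_gt h
  · intro h
    have hev : ∀ᶠ r in 𝓝[>] s, X r ω < t :=
      (hc.mono Ioi_subset_Ici_self).eventually_lt_const h
    obtain ⟨r, hrt, hsr⟩ := (hev.and self_mem_nhdsWithin).exists
    refine (ENNReal.coe_lt_coe.mpr hsr).trans_le (le_sInf ?_)
    rintro _ ⟨τ, ⟨-, hτt⟩, rfl⟩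
    by_contra! hτr
    exact (hrt.trans_le hτt).not_ge (hω (ENNReal.coe_lt_coe.mp hτr).le)

variable [MeasurableSpace Ω] {P : Measure Ω}

theorem IsSubordinator.aemeasurable_firstExitTime (hX : IsSubordinator X P) (t : ℝ) :
    AEMeasurable (firstExitTime X t) P := by
  have hq : AEMeasurable (fun ω ↦ ⨅ q : {q : ℚ // 0 < q},
      if t ≤ X (q : ℝ).toNNReal ω then ENNReal.ofReal (q : ℝ) else ⊤) P := by
    refine AEMeasurable.iInf fun q ↦ ?_
    have hg : Measurable fun x : ℝ ↦ if t ≤ x then ENNReal.ofReal (q : ℝ) else ⊤ :=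
      Measurable.ite measurableSet_Ici measurable_const measurable_const
    exact hg.comp_aemeasurable (hX.aemeasurable _)
  refine hq.congr ?_
  filter_upwards [hX.paths] with ω hω
  exact (firstExitTime_eq_iInf_rat hω.1 t).symm

/-- The mean exit time is the mean time that the subordinator spends below the level. -/
theorem IsSubordinator.lintegral_firstExitTime [SFinite P] (hX : IsSubordinator X P) (t : ℝ) :
    ∫⁻ ω, firstExitTime X t ω ∂P = ∫⁻ s in Ioi (0 : ℝ), P {ω | X s.toNNReal ω < t} := by
  rw [lintegral_eq_lintegral_meas_ofReal_lt (hX.aemeasurable_firstExitTime t)]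
  refine setLIntegral_congr_fun measurableSet_Ioi fun s hs ↦ measure_congr ?_
  filter_upwards [hX.paths] with ω hω
  exact propext (coe_lt_firstExitTime_iff hω.1 (Real.toNNReal_pos.mpr hs) (hω.2 _) t)

/-- The mean exit time is finite because `P(X_s < t)` decays exponentially in `s`, by Markov's
inequality applied to `e^{-X_s}`. -/
theorem lintegral_firstExitTime_lt_top [IsProbabilityMeasure P] {w : ℝ → ℝ}
    (hX : IsSubordinator X P) (hw : HasLevyDensity X w P) (hpos : 0 < laplaceExponent w 1) (t : ℝ) :
    ∫⁻ ω, firstExitTime X t ω ∂P < ⊤ := by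
  rw [hX.lintegral_firstExitTime]
  set b := laplaceExponent w 1
  have hbound : ∀ s ∈ Ioi (0 : ℝ), P {ω | X s.toNNReal ω < t} ≤
      ENNReal.ofReal (Real.exp t * Real.exp (-b * s)) := by
    intro s hs
    have hlap := hw.laplace s.toNNReal 1 zero_le_one
    have hint : Integrable (fun ω ↦ Real.exp (-(1 * X s.toNNReal ω))) P :=
      Integrable.of_integral_ne_zero (hlap ▸ (Real.exp_pos _).ne')
    have hmarkov := mul_meas_ge_le_integral_of_nonneg
      (ae_of_all _ fun ω ↦ (Real.exp_pos (-(1 * X s.toNNReal ω))).le) hint (Real.exp (-t))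
    rw [hlap, Real.coe_toNNReal s (le_of_lt hs)] at hmarkov
    have hsub : {ω | X s.toNNReal ω < t} ⊆
        {ω | Real.exp (-t) ≤ Real.exp (-(1 * X s.toNNReal ω))} := by
      intro ω hω
      have hω : X s.toNNReal ω < t := hω
      exact Real.exp_le_exp.mpr (by linarith)
    refine (measure_mono hsub).trans ((ENNReal.le_ofReal_iff_toReal_le (measure_ne_top _ _)
      (by positivity)).mpr ?_)
    rw [neg_mul, mul_comm b s, ← inv_mul_le_iff₀ (Real.exp_pos t), ← Real.exp_neg]
    exact hmarkov
  refine (setLIntegral_mono' measurableSet_Ioi hbound).trans_lt ?_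
  exact ((exp_neg_integrableOn_Ioi 0 hpos).const_mul (Real.exp t)).lintegral_lt_top

end FirstExit

/-! ### The double integral for the mean exit time -/

/-- The density `α e^{-lα} (lα)^{u-1} / (ν Γ(u))` integrated in the formula for the mean exit time:
`ν` times it is the density at `l` of the Gamma law with shape `u` and rate `α`. -/
noncomputable def gammaExitDensity (ν α l u : ℝ) : ℝ :=
  α * Real.exp (-(l * α)) * (l * α) ^ (u - 1) / (ν * Real.Gamma u)

theorem Real.measurable_Gamma : Measurable Real.Gamma := by
  have h : Measurable Complex.Gamma := by
    have h := Complex.differentiable_one_div_Gamma.continuous.measurable.inv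
    simpa only [Pi.inv_def, inv_inv] using h
  exact Complex.measurable_re.comp (h.comp Complex.measurable_ofReal)

theorem measurable_gammaExitDensity (ν α : ℝ) :
    Measurable fun z : ℝ × ℝ ↦ gammaExitDensity ν α z.1 z.2 := by
  have := Real.measurable_Gamma
  unfold gammaExitDensity
  fun_prop

theorem gammaExitDensity_nonneg {ν α l u : ℝ} (hν : 0 < ν) (hα : 0 < α) (hl : 0 < l) (hu : 0 < u) :
    0 ≤ gammaExitDensity ν α l u := by
  have := Real.Gamma_pos_of_pos hu
  unfold gammaExitDensity
  positivity

theorem gammaPDF_eq_gammaExitDensity {ν α l u : ℝ} (hν : 0 < ν) (hα : 0 < α) (hl : 0 < l) :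
    gammaPDF u α l = ENNReal.ofReal ν * ENNReal.ofReal (gammaExitDensity ν α l u) := by
  rw [gammaPDF_of_nonneg hl.le, ← ENNReal.ofReal_mul hν.le, gammaExitDensity,
    Real.mul_rpow hl.le hα.le, mul_comm l α]
  congr 1
  have : α ^ u = α * α ^ (u - 1) := by
    rw [Real.rpow_sub_one hα.ne']
    field_simp
  rw [this]
  field_simp

theorem MeasureTheory.lintegral_Ioi_comp_mul_left {c : ℝ} (hc : 0 < c) (g : ℝ → ℝ≥0∞) :
    ∫⁻ s in Ioi (0 : ℝ), ENNReal.ofReal c * g (c * s) = ∫⁻ u in Ioi (0 : ℝ), g u := by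
  have key := lintegral_image_eq_lintegral_abs_deriv_mul (f := fun s ↦ c * s) (f' := fun _ ↦ c)
    (measurableSet_Ioi (a := (0 : ℝ)))
    (fun s _ ↦ by simpa using ((hasDerivAt_id s).const_mul c).hasDerivWithinAt)
    (mul_right_injective₀ hc.ne').injOn g
  rw [abs_of_pos hc, image_mul_left_Ioi hc, mul_zero] at key
  exact key.symm

section GammaExit

variable {Ω : Type*} [MeasurableSpace Ω] {P : Measure Ω} [IsProbabilityMeasure P]
  {X : ℝ≥0 → Ω → ℝ} {ν α : ℝ}

theorem IsGammaSubordinator.measure_lt (hν : 0 < ν) (hα : 0 < α)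
    (hX : IsGammaSubordinator X ν α P) {s : ℝ≥0} (hs : 0 < s) (t : ℝ) :
    P {ω | X s ω < t} =
      ∫⁻ l in Ioc 0 t, ENNReal.ofReal ν * ENNReal.ofReal (gammaExitDensity ν α l (ν * s)) := by
  have hlaw : P {ω | X s ω < t} = P.map (X s) (Iio t) :=
    (Measure.map_apply_of_aemeasurable (hX.isSubordinator.aemeasurable s) measurableSet_Iio).symm
  -- The Gamma law has a density supported in `[0, ∞)`, so neither endpoint of `(0, t]` matters.
  have hpos : ∫⁻ l in Iic t \ Ioc 0 t, gammaPDF (ν * s) α l = 0 := by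
    have : Iic t \ Ioc 0 t ⊆ Iic 0 := fun l hl ↦
      not_lt.mp fun h ↦ hl.2 ⟨h, hl.1⟩
    refine le_antisymm ((lintegral_mono_set this).trans ?_) (zero_le (a := _))
    rw [← setLIntegral_congr Iio_ae_eq_Iic, lintegral_gammaPDF_of_nonpos le_rfl]
  rw [hlaw, hX.map_eq_gammaMeasure hν hα hs, gammaMeasure, withDensity_apply _ measurableSet_Iio,
    setLIntegral_congr Iio_ae_eq_Iic,
    ← lintegral_inter_add_sdiff _ _ (measurableSet_Ioc (a := 0) (b := t)), hpos, add_zero,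
    inter_eq_right.mpr Ioc_subset_Iic_self]
  exact setLIntegral_congr_fun measurableSet_Ioc fun l hl ↦
    gammaPDF_eq_gammaExitDensity hν hα hl.1

theorem IsGammaSubordinator.lintegral_firstExitTime (hν : 0 < ν) (hα : 0 < α)
    (hX : IsGammaSubordinator X ν α P) (t : ℝ) :
    ∫⁻ ω, firstExitTime X t ω ∂P =
      ∫⁻ z, ENNReal.ofReal (gammaExitDensity ν α z.1 z.2)
        ∂(volume.restrict (Ioc 0 t)).prod (volume.restrict (Ioi 0)) := by
  have hm := measurable_gammaExitDensity ν α
  rw [hX.isSubordinator.lintegral_firstExitTime, lintegral_prod _ (by fun_prop)]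
  calc ∫⁻ s in Ioi (0 : ℝ), P {ω | X s.toNNReal ω < t}
      = ∫⁻ s in Ioi (0 : ℝ), ∫⁻ l in Ioc 0 t,
          ENNReal.ofReal ν * ENNReal.ofReal (gammaExitDensity ν α l (ν * s)) := by
        refine setLIntegral_congr_fun measurableSet_Ioi fun s hs ↦ ?_
        rw [hX.measure_lt hν hα (Real.toNNReal_pos.mpr hs), Real.coe_toNNReal s (le_of_lt hs)]
    _ = ∫⁻ l in Ioc 0 t, ∫⁻ s in Ioi (0 : ℝ),
          ENNReal.ofReal ν * ENNReal.ofReal (gammaExitDensity ν α l (ν * s)) := by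
        have hm' : Measurable fun p : ℝ × ℝ ↦ gammaExitDensity ν α p.2 (ν * p.1) :=
          hm.comp (measurable_snd.prodMk (measurable_fst.const_mul ν))
        exact lintegral_lintegral_swap (hm'.ennreal_ofReal.const_mul _).aemeasurable
    _ = ∫⁻ l in Ioc 0 t, ∫⁻ u in Ioi (0 : ℝ), ENNReal.ofReal (gammaExitDensity ν α l u) :=
        lintegral_congr fun l ↦ lintegral_Ioi_comp_mul_left hν fun u ↦
          ENNReal.ofReal (gammaExitDensity ν α l u)

theorem ae_gammaExitDensity_nonneg (hν : 0 < ν) (hα : 0 < α) (t : ℝ) :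
    ∀ᵐ z ∂(volume.restrict (Ioc 0 t)).prod (volume.restrict (Ioi 0)),
      0 ≤ gammaExitDensity ν α z.1 z.2 := by
  rw [Measure.prod_restrict]
  exact (ae_restrict_iff' (measurableSet_Ioc.prod measurableSet_Ioi)).mpr
    (ae_of_all _ fun z hz ↦ gammaExitDensity_nonneg hν hα hz.1.1 hz.2)

/-- The double integral converges absolutely, since its value is the finite mean exit time. -/
theorem IsGammaSubordinator.integrable_gammaExitDensity (hν : 0 < ν) (hα : 0 < α)
    (hX : IsGammaSubordinator X ν α P) (t : ℝ) :
    Integrable (fun z : ℝ × ℝ ↦ gammaExitDensity ν α z.1 z.2)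
      ((volume.restrict (Ioc 0 t)).prod (volume.restrict (Ioi 0))) := by
  refine ⟨(measurable_gammaExitDensity ν α).aestronglyMeasurable, ?_⟩
  rw [hasFiniteIntegral_iff_ofReal (ae_gammaExitDensity_nonneg hν hα t),
    ← hX.lintegral_firstExitTime hν hα]
  refine lintegral_firstExitTime_lt_top hX.isSubordinator hX.hasLevyDensity ?_ t
  rw [laplaceExponent_gamma hα zero_le_one]
  exact mul_pos hν (Real.log_pos ((one_lt_div hα).mpr (by linarith)))

end GammaExit

/-- Integrability in `u` of the density at two points `l₁ < l₂` passes to every `l` in between,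
since `(l α) ^ (u - 1)` is monotone in `l` for `1 ≤ u` and antitone for `u ≤ 1`. -/
theorem integrableOn_gammaExitDensity_of_between {ν α l₁ l l₂ : ℝ} (hν : 0 < ν) (hα : 0 < α)
    (h₀ : 0 < l₁) (h₁ : l₁ ≤ l) (h₂ : l ≤ l₂)
    (hi₁ : IntegrableOn (gammaExitDensity ν α l₁) (Ioi 0))
    (hi₂ : IntegrableOn (gammaExitDensity ν α l₂) (Ioi 0)) :
    IntegrableOn (gammaExitDensity ν α l) (Ioi 0) := by
  have hl : 0 < l := h₀.trans_le h₁
  have hdom := ((hi₁.const_mul (Real.exp (l₁ * α))).add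
    (hi₂.const_mul (Real.exp (l₂ * α)))).const_mul (Real.exp (-(l * α)))
  refine Integrable.mono' hdom ((measurable_gammaExitDensity ν α).comp
    measurable_prodMk_left).aestronglyMeasurable ((ae_restrict_iff' measurableSet_Ioi).mpr
      (ae_of_all _ fun u hu ↦ ?_))
  rw [Real.norm_of_nonneg (gammaExitDensity_nonneg hν hα hl hu)]
  have hΓ := Real.Gamma_pos_of_pos hu
  have hle : (l * α) ^ (u - 1) ≤ (l₁ * α) ^ (u - 1) + (l₂ * α) ^ (u - 1) := by
    have p₁ : 0 ≤ (l₁ * α) ^ (u - 1) := by positivity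
    have p₂ : 0 ≤ (l₂ * α) ^ (u - 1) := Real.rpow_nonneg (by nlinarith) _
    rcases le_total u 1 with h | h
    · have := Real.rpow_le_rpow_of_nonpos (by positivity : 0 < l₁ * α)
        (by gcongr : l₁ * α ≤ l * α) (sub_nonpos.mpr h)
      linarith
    · have := Real.rpow_le_rpow (by positivity : 0 ≤ l * α)
        (by gcongr : l * α ≤ l₂ * α) (sub_nonneg.mpr h)
      linarith
  have cancel (m : ℝ) : Real.exp (m * α) * gammaExitDensity ν α m u =
      α * (m * α) ^ (u - 1) / (ν * Real.Gamma u) := by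
    rw [gammaExitDensity, Real.exp_neg]
    field_simp
  calc gammaExitDensity ν α l u
      = Real.exp (-(l * α)) * (α * (l * α) ^ (u - 1) / (ν * Real.Gamma u)) := by
        rw [gammaExitDensity]
        ring
    _ ≤ Real.exp (-(l * α)) *
          (α * ((l₁ * α) ^ (u - 1) + (l₂ * α) ^ (u - 1)) / (ν * Real.Gamma u)) := by gcongr
    _ = Real.exp (-(l * α)) * (Real.exp (l₁ * α) * gammaExitDensity ν α l₁ u +
          Real.exp (l₂ * α) * gammaExitDensity ν α l₂ u) := by
        rw [cancel, cancel]
        ring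

/-- The integral in `u` converges at every `l > 0`, not only almost everywhere: `l` lies between two
points at which it converges. -/
theorem IsGammaSubordinator.integrableOn_gammaExitDensity {Ω : Type*} [MeasurableSpace Ω]
    {P : Measure Ω} [IsProbabilityMeasure P] {X : ℝ≥0 → Ω → ℝ} {ν α l : ℝ} (hν : 0 < ν)
    (hα : 0 < α) (hX : IsGammaSubordinator X ν α P) (hl : 0 < l) :
    IntegrableOn (gammaExitDensity ν α l) (Ioi 0) := by
  have hae := (hX.integrable_gammaExitDensity hν hα (l + 1)).prod_right_ae
  have exists_mem {a b : ℝ} (ha : 0 ≤ a) (hab : a < b) (hb : b ≤ l + 1) :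
      ∃ m ∈ Ioo a b, IntegrableOn (gammaExitDensity ν α m) (Ioi 0) := by
    have hsub : Ioo a b ⊆ Ioc 0 (l + 1) := fun x hx ↦ ⟨ha.trans_lt hx.1, hx.2.le.trans hb⟩
    have : NeBot (ae (volume.restrict (Ioo a b))) := by
      rw [ae_restrict_neBot, Real.volume_Ioo]
      simpa using hab
    obtain ⟨m, hm, hmem⟩ :=
      ((ae_restrict_of_ae_restrict_of_subset hsub hae).and
        (ae_restrict_mem measurableSet_Ioo)).exists
    exact ⟨m, hmem, hm⟩
  obtain ⟨l₁, hl₁, hi₁⟩ := exists_mem le_rfl hl (by linarith)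
  obtain ⟨l₂, hl₂, hi₂⟩ := exists_mem hl.le (lt_add_one l) le_rfl
  exact integrableOn_gammaExitDensity_of_between hν hα hl₁.1 hl₁.2.le hl₂.1.le hi₁ hi₂

theorem mainTheorem5 {Ω : Type*} [MeasurableSpace Ω] (P : Measure Ω) [IsProbabilityMeasure P]
    (X : ℝ≥0 → Ω → ℝ) (ν α : ℝ) (hν : 0 < ν) (hα : 0 < α) (hX : IsGammaSubordinator X ν α P)
    (t : ℝ) (ht : 0 < t) :
    AEMeasurable (firstExitTime X t) P ∧
    (∀ l ∈ Ioc 0 t, IntegrableOn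
      (fun u : ℝ ↦ α * Real.exp (-(l * α)) * (l * α) ^ (u - 1) / (ν * Real.Gamma u)) (Ioi 0)) ∧
    IntervalIntegrable (fun l : ℝ ↦ ∫ u in Ioi (0 : ℝ),
      α * Real.exp (-(l * α)) * (l * α) ^ (u - 1) / (ν * Real.Gamma u)) volume 0 t ∧
    ∫⁻ ω, firstExitTime X t ω ∂P = ENNReal.ofReal (∫ l in (0 : ℝ)..t, ∫ u in Ioi (0 : ℝ),
      α * Real.exp (-(l * α)) * (l * α) ^ (u - 1) / (ν * Real.Gamma u)) := by
  have hint := hX.integrable_gammaExitDensity hν hα t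
  refine ⟨hX.isSubordinator.aemeasurable_firstExitTime t,
    fun l hl ↦ hX.integrableOn_gammaExitDensity hν hα hl.1,
    (intervalIntegrable_iff_integrableOn_Ioc_of_le ht.le).mpr hint.integral_prod_left, ?_⟩
  rw [hX.lintegral_firstExitTime hν hα, intervalIntegral.integral_of_le ht.le,
    ← ofReal_integral_eq_lintegral_ofReal hint (ae_gammaExitDensity_nonneg hν hα t),
    integral_prod _ hint]
  rfl
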